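/- Let $K$ be a field of characteristic different from $2$. A Lie superalgebra over $K$ is a $\mathbb{Z}_2$-graded vector space $L=L_{\bar 0}\oplus L_{\bar 1}$ with an even bilinear bracket satisfying $[x,y]=-(-1)^{|x||y|}[y,x]$ and $[x,[y,z]]=[[x,y],z]+(-1)^{|x||y|}[y,[x,z]]$ for homogeneous $x,y$, and $[x,[x,x]]=0$ for odd $x$ (the last condition is automatic unless $\operatorname{char}K=3$). Let $Z(L)=\{x\in L: [x,y]=0 \text{ for all } y\in L\}$, $L'=[L,L]$, and $Z_2(L)=\{x\in L: [x,y]\in Z(L)\text{ for all } y\in L\}$, a graded ideal of $L$. A Lie superalgebra $L$ is called $2$-capable if there is a Lie superalgebra $H$ over $K$, not necessarily finite dimensional, with $L\cong H/Z_2(H)$. A special Heisenberg Lie superalgebra $H(m,n)$, where $m,n\ge 0$ are integers, is a finite dimensional Lie superalgebra $L$ with $\dim L_{\bar 0}=2m+1$, $\dim L_{\bar 1}=n$, $Z(L)=L'$, $\dim Z(L)=1$ and $Z(L)\subseteq L_{\bar 0}$. **Theorem.** Let $L$ be a special Heisenberg Lie superalgebra $H(m,n)$. Then $L$ is $2$-capable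 if and only if $m=1$ and $n=0$. -/

import Mathlib

universe u v w

/-- A Lie superalgebra structure on a vector space `L` over a field `K` of characteristic
different from `2`: a `ℤ/2`-grading `L = L₀ ⊕ L₁` and an even bilinear bracket satisfying graded
skew-symmetry and the graded Jacobi identity. As usual `[x, [x, x]] = 0` is required for odd `x`;
this follows from the Jacobi identity unless the characteristic is `3`. -/
structure LieSuperalgebra (K : Type u) (L : Type v) [Field K] [AddCommGroup L] [Module K L] where
  /-- the homogeneous components -/
  grade : ZMod 2 → Submodule K L
  isCompl : IsCompl (grade 0) (grade 1)
  /-- the Lie superbracket -/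
  bracket : L →ₗ[K] L →ₗ[K] L
  bracket_mem : ∀ (i j : ZMod 2) (x y : L), x ∈ grade i → y ∈ grade j →
    bracket x y ∈ grade (i + j)
  skew : ∀ (i j : ZMod 2) (x y : L), x ∈ grade i → y ∈ grade j →
    bracket x y = -((-1 : K) ^ (i.val * j.val) • bracket y x)
  jacobi : ∀ (i j : ZMod 2) (x y z : L), x ∈ grade i → y ∈ grade j →
    bracket x (bracket y z) =
      bracket (bracket x y) z + (-1 : K) ^ (i.val * j.val) • bracket y (bracket x z)
  odd_cube : ∀ x : L, x ∈ grade 1 → bracket x (bracket x x) = 0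

namespace LieSuperalgebra

section

variable {K : Type u} {L : Type v} [Field K] [AddCommGroup L] [Module K L]

/-- A graded (two-sided) ideal. -/
structure IsGradedIdeal (S : LieSuperalgebra K L) (I : Submodule K L) : Prop where
  graded : I ≤ (I ⊓ S.grade 0) ⊔ (I ⊓ S.grade 1)
  bracket_left : ∀ x ∈ I, ∀ y : L, S.bracket x y ∈ I
  bracket_right : ∀ x : L, ∀ y ∈ I, S.bracket x y ∈ I

theorem exists_add (S : LieSuperalgebra K L) (x : L) :
    ∃ a ∈ S.grade 0, ∃ b ∈ S.grade 1, a + b = x := by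
  have h : x ∈ S.grade 0 ⊔ S.grade 1 := by
    rw [S.isCompl.sup_eq_top]; exact Submodule.mem_top
  exact Submodule.mem_sup.1 h

theorem mem_of_add_mem (S : LieSuperalgebra K L) {I : Submodule K L}
    (hI : I ≤ (I ⊓ S.grade 0) ⊔ (I ⊓ S.grade 1)) {a b : L} (ha : a ∈ S.grade 0)
    (hb : b ∈ S.grade 1) (h : a + b ∈ I) : a ∈ I ∧ b ∈ I := by
  obtain ⟨c, hc, d, hd, hcd⟩ := Submodule.mem_sup.1 (hI h)
  have e : a - c = d - b := by
    rw [sub_eq_sub_iff_add_eq_add, ← hcd, add_comm]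
  have h0 : a - c = 0 := by
    have hmem : a - c ∈ S.grade 0 ⊓ S.grade 1 :=
      ⟨Submodule.sub_mem _ ha hc.2, by
        rw [e]; exact Submodule.sub_mem _ hd.2 hb⟩
    rw [S.isCompl.inf_eq_bot] at hmem
    simpa using hmem
  have h1 : d - b = 0 := by rw [← e, h0]
  rw [sub_eq_zero] at h0 h1
  exact ⟨h0 ▸ hc.1, h1 ▸ hd.1⟩

/-- A graded subspace closed under bracketing on the right is a two-sided graded ideal. -/
theorem IsGradedIdeal.of_left (S : LieSuperalgebra K L) (I : Submodule K L)
    (hI : I ≤ (I ⊓ S.grade 0) ⊔ (I ⊓ S.grade 1))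
    (hl : ∀ x ∈ I, ∀ y : L, S.bracket x y ∈ I) : S.IsGradedIdeal I := by
  refine ⟨hI, hl, ?_⟩
  have key : ∀ (i j : ZMod 2) (x y : L), x ∈ S.grade i → y ∈ S.grade j → y ∈ I →
      S.bracket x y ∈ I := by
    intro i j x y hx hy hyI
    rw [S.skew i j x y hx hy]
    exact I.neg_mem (I.smul_mem _ (hl y hyI x))
  intro x y hy
  obtain ⟨a, ha, b, hb, rfl⟩ := S.exists_add x
  obtain ⟨c, hc, d, hd, rfl⟩ := Submodule.mem_sup.1 (hI hy)
  simp only [map_add, LinearMap.add_apply]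
  exact I.add_mem (I.add_mem (key 0 0 a c ha hc.2 hc.1) (key 1 0 b c hb hc.2 hc.1))
    (I.add_mem (key 0 1 a d ha hd.2 hd.1) (key 1 1 b d hb hd.2 hd.1))

/-- The upper central series: `Z₀(L) = 0`, `Zₙ₊₁(L) = {x | [x, y] ∈ Zₙ(L) for all y}`. -/
def upperCentral (S : LieSuperalgebra K L) : ℕ → Submodule K L
  | 0 => ⊥
  | n + 1 =>
    { carrier := {x | ∀ y : L, S.bracket x y ∈ S.upperCentral n}
      zero_mem' := fun y => by simp
      add_mem' := fun {a b} ha hb y => by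
        simpa using Submodule.add_mem _ (ha y) (hb y)
      smul_mem' := fun c a ha y => by
        simpa using Submodule.smul_mem _ c (ha y) }

theorem mem_upperCentral_succ (S : LieSuperalgebra K L) (n : ℕ) (x : L) :
    x ∈ S.upperCentral (n + 1) ↔ ∀ y : L, S.bracket x y ∈ S.upperCentral n :=
  Iff.rfl

theorem upperCentral_le_succ (S : LieSuperalgebra K L) (n : ℕ) :
    S.upperCentral n ≤ S.upperCentral (n + 1) := by
  induction n with
  | zero => exact bot_le
  | succ k ih => exact fun x hx y => ih (hx y)

theorem upperCentral_isGradedIdeal (S : LieSuperalgebra K L) (n : ℕ) :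
    S.IsGradedIdeal (S.upperCentral n) := by
  have hl : ∀ x ∈ S.upperCentral n, ∀ y : L, S.bracket x y ∈ S.upperCentral n :=
    fun x hx y => S.upperCentral_le_succ n hx y
  refine IsGradedIdeal.of_left S _ ?_ hl
  clear hl
  induction n with
  | zero => exact bot_le
  | succ k ih =>
    intro x hx
    obtain ⟨a, ha, b, hb, rfl⟩ := S.exists_add x
    have h0 : ∀ y ∈ S.grade 0,
        S.bracket a y ∈ S.upperCentral k ∧ S.bracket b y ∈ S.upperCentral k := by
      intro y hy
      have h := hx y
      rw [map_add, LinearMap.add_apply] at h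
      exact S.mem_of_add_mem ih (S.bracket_mem 0 0 a y ha hy) (S.bracket_mem 1 0 b y hb hy) h
    have h1 : ∀ y ∈ S.grade 1,
        S.bracket a y ∈ S.upperCentral k ∧ S.bracket b y ∈ S.upperCentral k := by
      intro y hy
      have h := hx y
      rw [map_add, LinearMap.add_apply, add_comm] at h
      exact (S.mem_of_add_mem ih (S.bracket_mem 1 1 b y hb hy)
        (S.bracket_mem 0 1 a y ha hy) h).symm
    have hab : a ∈ S.upperCentral (k + 1) ∧ b ∈ S.upperCentral (k + 1) := by
      constructor <;>
      · intro y
        obtain ⟨c, hc, d, hd, rfl⟩ := S.exists_add y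
        rw [map_add]
        first
          | exact Submodule.add_mem _ (h0 c hc).1 (h1 d hd).1
          | exact Submodule.add_mem _ (h0 c hc).2 (h1 d hd).2
    exact Submodule.add_mem_sup ⟨hab.1, ha⟩ ⟨hab.2, hb⟩

/-- The center `Z(L)`, the first term of the upper central series. -/
def center (S : LieSuperalgebra K L) : Submodule K L := S.upperCentral 1

theorem mem_center (S : LieSuperalgebra K L) (x : L) :
    x ∈ S.center ↔ ∀ y : L, S.bracket x y = 0 := by
  change (∀ y : L, S.bracket x y ∈ (⊥ : Submodule K L)) ↔ _
  simp

/-- The derived subalgebra `L' = [L, L]`. -/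
def derived (S : LieSuperalgebra K L) : Submodule K L :=
  Submodule.span K {z | ∃ x y : L, S.bracket x y = z}

/-- The bracket induced on the quotient by a graded ideal. -/
def quotientBracket (S : LieSuperalgebra K L) (I : Submodule K L) (hI : S.IsGradedIdeal I) :
    (L ⧸ I) →ₗ[K] (L ⧸ I) →ₗ[K] (L ⧸ I) :=
  I.liftQ
    { toFun := fun x => I.mapQ I (S.bracket x) (fun y hy => hI.bracket_right x y hy)
      map_add' := fun x x' => by
        ext y
        simp
      map_smul' := fun c x => by
        ext y
        simp }
    (by
      intro x hx
      rw [LinearMap.mem_ker]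
      ext y
      simpa using hI.bracket_left x hx y)

@[simp]
theorem quotientBracket_mk (S : LieSuperalgebra K L) (I : Submodule K L)
    (hI : S.IsGradedIdeal I) (x y : L) :
    S.quotientBracket I hI (I.mkQ x) (I.mkQ y) = I.mkQ (S.bracket x y) :=
  rfl

/-- The quotient of a Lie superalgebra by a graded ideal, with the induced grading and bracket. -/
def quotient (S : LieSuperalgebra K L) (I : Submodule K L) (hI : S.IsGradedIdeal I) :
    LieSuperalgebra K (L ⧸ I) where
  grade i := (S.grade i).map I.mkQ
  isCompl := by
    constructor
    · rw [Submodule.disjoint_def]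
      rintro _ ⟨a, ha, rfl⟩ ⟨b, hb, hab⟩
      have h : a + -b ∈ I := by
        rw [← sub_eq_add_neg]
        exact (Submodule.Quotient.eq I).1 hab.symm
      have := (S.mem_of_add_mem hI.graded ha (Submodule.neg_mem _ hb) h).1
      simpa using this
    · rw [codisjoint_iff, ← Submodule.map_sup, S.isCompl.sup_eq_top, Submodule.map_top,
        Submodule.range_mkQ]
  bracket := S.quotientBracket I hI
  bracket_mem := by
    rintro i j _ _ ⟨x, hx, rfl⟩ ⟨y, hy, rfl⟩
    exact ⟨_, S.bracket_mem i j x y hx hy, rfl⟩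
  skew := by
    rintro i j _ _ ⟨x, hx, rfl⟩ ⟨y, hy, rfl⟩
    rw [quotientBracket_mk, quotientBracket_mk, S.skew i j x y hx hy, map_neg, map_smul]
  jacobi := by
    rintro i j _ _ z ⟨x, hx, rfl⟩ ⟨y, hy, rfl⟩
    obtain ⟨z, rfl⟩ := I.mkQ_surjective z
    simp only [quotientBracket_mk]
    rw [S.jacobi i j x y z hx hy, map_add, map_smul]
  odd_cube := by
    rintro _ ⟨x, hx, rfl⟩
    simp only [quotientBracket_mk]
    rw [S.odd_cube x hx, map_zero]

end

/-- Isomorphism of Lie superalgebras: an even linear bijection preserving the bracket. -/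
def IsIsomorphic {K : Type u} [Field K] {L : Type*} [AddCommGroup L] [Module K L]
    {M : Type*} [AddCommGroup M] [Module K M]
    (S : LieSuperalgebra K L) (T : LieSuperalgebra K M) : Prop :=
  ∃ e : L ≃ₗ[K] M,
    (∀ (i : ZMod 2) (x : L), x ∈ S.grade i ↔ e x ∈ T.grade i) ∧
    ∀ x y : L, e (S.bracket x y) = T.bracket (e x) (e y)

/-- `L` is `2`-capable if `L ≅ H / Z₂(H)` for some Lie superalgebra `H` over the same field.
`H` is not assumed finite dimensional and lives in a universe at least that of `K`; the universe
level `w` is arbitrary. -/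
def IsTwoCapable {K : Type u} [Field K] {L : Type v} [AddCommGroup L] [Module K L]
    (S : LieSuperalgebra K L) : Prop :=
  ∃ (H : Type (max u w)) (_ : AddCommGroup H) (_ : Module K H) (T : LieSuperalgebra K H),
    S.IsIsomorphic (T.quotient (T.upperCentral 2) (T.upperCentral_isGradedIdeal 2))

/-- `L` is a special Heisenberg Lie superalgebra `H(m, n)`: it is finite dimensional with
`Z(L) = L'` one-dimensional and even, and has superdimension `(2m + 1 | n)`. -/
structure IsSpecialHeisenberg {K : Type u} [Field K] {L : Type v} [AddCommGroup L] [Module K L]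
    (S : LieSuperalgebra K L) (m n : ℕ) : Prop where
  finiteDimensional : FiniteDimensional K L
  center_eq_derived : S.center = S.derived
  finrank_center : Module.finrank K S.center = 1
  center_even : S.center ≤ S.grade 0
  finrank_even : Module.finrank K (S.grade 0) = 2 * m + 1
  finrank_odd : Module.finrank K (S.grade 1) = n

end LieSuperalgebra

namespace LieSuperalgebra

/-! ### Elementary consequences of grading and skew-symmetry -/

section Basic

variable {K : Type u} {L : Type v} [Field K] [AddCommGroup L] [Module K L]

/-! Suppose `L ≅ H/Z₂(H)`, with projection `p : H → L`, and let an even `z` in `H` lift a generator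
of `Z(L)`. Outside the case `(1, 0)`, every `[z, h]` is central in `H`; so `z ∈ Z₂(H)` and `p z =
0`, a contradiction.

The tool is to replace `z`, modulo `Z₂(H)` and up to a nonzero scalar, by a bracket suited to `h`.
For even `h`, take `[x, y]` with `p x`, `p y` noncommuting but both commuting with `p h`: then `[h,
x]` and `[h, y]` lie in `Z₂(H)`, and Jacobi makes `[h, [x, y]]` central
(`bracket_mem_center_of_even`). Such a pair exists among odd elements if `n > 0`, and by a dimension
count if `n = 0` and `m ≥ 2`. Odd `h` are handled with `[h, h]` or `[h, k]`
(`bracket_mem_center_of_odd`).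

Conversely, the Heisenberg algebra of dimension three is the five-dimensional filiform algebra
modulo its second center. -/

theorem bracket_mem_swap (S : LieSuperalgebra K L) (I : Submodule K L) {i j : ZMod 2} {x y : L}
    (hx : x ∈ S.grade i) (hy : y ∈ S.grade j) (h : S.bracket y x ∈ I) : S.bracket x y ∈ I := by
  rw [S.skew i j x y hx hy]
  exact I.neg_mem (I.smul_mem _ h)

theorem eq_zero_of_mem_even_of_mem_odd (S : LieSuperalgebra K L) {x : L}
    (h0 : x ∈ S.grade 0) (h1 : x ∈ S.grade 1) : x = 0 :=
  Submodule.disjoint_def.1 S.isCompl.disjoint x h0 h1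

theorem bracket_self_of_even (S : LieSuperalgebra K L) (hK : (2 : K) ≠ 0) {x : L}
    (hx : x ∈ S.grade 0) : S.bracket x x = 0 := by
  have h := S.skew 0 0 x x hx hx
  simp only [ZMod.val_zero, mul_zero, pow_zero, one_smul] at h
  have h2 : (2 : K) • S.bracket x x = 0 := by
    rw [two_smul]
    nth_rewrite 1 [h]
    exact neg_add_cancel _
  exact (smul_eq_zero.1 h2).resolve_left hK

theorem bracket_mem_derived (S : LieSuperalgebra K L) (x y : L) : S.bracket x y ∈ S.derived :=
  Submodule.subset_span ⟨x, y, rfl⟩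

end Basic

/-! ### Structure of special Heisenberg superalgebras -/

section Heisenberg

variable {K : Type u} {L : Type v} [Field K] [AddCommGroup L] [Module K L]
  {S : LieSuperalgebra K L} {m n : ℕ}

namespace IsSpecialHeisenberg

theorem bracket_mem_center (hS : S.IsSpecialHeisenberg m n) (x y : L) :
    S.bracket x y ∈ S.center := by
  rw [hS.center_eq_derived]
  exact S.bracket_mem_derived x y

theorem exists_center_generator (hS : S.IsSpecialHeisenberg m n) :
    ∃ z ∈ S.center, z ≠ 0 ∧ ∀ w ∈ S.center, ∃ c : K, w = c • z := by
  obtain ⟨⟨z, hz⟩, hz0, h⟩ := finrank_eq_one_iff'.1 hS.finrank_center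
  refine ⟨z, hz, fun h0 => hz0 (Subtype.ext h0), fun w hw => ?_⟩
  obtain ⟨c, hc⟩ := h ⟨w, hw⟩
  exact ⟨c, (congrArg Subtype.val hc).symm⟩

theorem exists_bracket_ne_zero (hS : S.IsSpecialHeisenberg m n) :
    ∃ a b : L, S.bracket a b ≠ 0 := by
  by_contra! h
  obtain ⟨z, hz, hz0, -⟩ := hS.exists_center_generator
  rw [hS.center_eq_derived] at hz
  have : S.derived ≤ ⊥ := by
    refine Submodule.span_le.2 ?_
    rintro _ ⟨x, y, rfl⟩
    exact h x y
  exact hz0 (by simpa using this hz)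

/-- The bracket is odd by parity, yet it lies in the center, which is even. -/
theorem bracket_even_odd (hS : S.IsSpecialHeisenberg m n) {x y : L}
    (hx : x ∈ S.grade 0) (hy : y ∈ S.grade 1) : S.bracket x y = 0 :=
  S.eq_zero_of_mem_even_of_mem_odd (hS.center_even (hS.bracket_mem_center x y))
    (by simpa using S.bracket_mem 0 1 x y hx hy)

theorem bracket_odd_even (hS : S.IsSpecialHeisenberg m n) {x y : L}
    (hx : x ∈ S.grade 1) (hy : y ∈ S.grade 0) : S.bracket x y = 0 :=
  S.eq_zero_of_mem_even_of_mem_odd (hS.center_even (hS.bracket_mem_center x y))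
    (by simpa using S.bracket_mem 1 0 x y hx hy)

/-- Nondegeneracy on the odd part: an odd element already commutes with the even part, so if it
killed the odd part too it would be central, hence even, hence zero. -/
theorem exists_odd_bracket_ne_zero (hS : S.IsSpecialHeisenberg m n) {a : L}
    (ha : a ∈ S.grade 1) (ha0 : a ≠ 0) : ∃ b ∈ S.grade 1, S.bracket a b ≠ 0 := by
  by_contra! h
  refine ha0 (S.eq_zero_of_mem_even_of_mem_odd (hS.center_even ?_) ha)
  rw [S.mem_center]
  intro y
  obtain ⟨c, hc, d, hd, rfl⟩ := S.exists_add y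
  rw [map_add, hS.bracket_odd_even ha hc, h d hd, add_zero]

theorem finrank_eq (hS : S.IsSpecialHeisenberg m n) : Module.finrank K L = 2 * m + 1 + n := by
  have := hS.finiteDimensional
  rw [← Submodule.finrank_add_eq_of_isCompl S.isCompl, hS.finrank_even, hS.finrank_odd]

theorem grade_one_eq_bot (hS : S.IsSpecialHeisenberg m 0) : S.grade 1 = ⊥ := by
  have := hS.finiteDimensional
  exact Submodule.finrank_eq_zero.1 hS.finrank_odd

theorem grade_zero_eq_top (hS : S.IsSpecialHeisenberg m 0) : S.grade 0 = ⊤ := by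
  have h := S.isCompl.sup_eq_top
  rwa [hS.grade_one_eq_bot, sup_bot_eq] at h

theorem bracket_skew (hS : S.IsSpecialHeisenberg m 0) (x y : L) :
    S.bracket x y = - S.bracket y x := by
  have h : ∀ x : L, x ∈ S.grade 0 := fun x => by
    rw [hS.grade_zero_eq_top]; exact Submodule.mem_top
  simpa using S.skew 0 0 x y (h x) (h y)

/-- The kernel of a linear map into a line has codimension at most one. -/
theorem finrank_le_finrank_ker_add_one (hS : S.IsSpecialHeisenberg m n)
    {V : Type*} [AddCommGroup V] [Module K V] [FiniteDimensional K V] (f : V →ₗ[K] L)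
    (hf : ∀ x, f x ∈ S.center) :
    Module.finrank K V ≤ Module.finrank K (LinearMap.ker f) + 1 := by
  have := hS.finiteDimensional
  have h1 := LinearMap.finrank_range_add_finrank_ker f
  have h2 : LinearMap.range f ≤ S.center := by
    rintro _ ⟨x, rfl⟩
    exact hf x
  have h3 := Submodule.finrank_mono h2
  rw [hS.finrank_center] at h3
  omega

/-- In a Heisenberg Lie algebra of dimension at least five, no centralizer of an element is
abelian. -/
theorem exists_noncommuting_of_centralizer (hS : S.IsSpecialHeisenberg m 0) (hm : 2 ≤ m) (a : L) :
    ∃ x y : L, S.bracket a x = 0 ∧ S.bracket a y = 0 ∧ S.bracket x y ≠ 0 := by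
  have := hS.finiteDimensional
  by_contra! h
  obtain ⟨z, -, -, hgen⟩ := hS.exists_center_generator
  have hL := hS.finrank_eq
  let C : Submodule K L := LinearMap.ker (S.bracket a)
  have hC : Module.finrank K L ≤ Module.finrank K C + 1 :=
    hS.finrank_le_finrank_ker_add_one (S.bracket a) (hS.bracket_mem_center a)
  obtain ⟨d, hd⟩ : ∃ d, d ∉ C := by
    by_contra! hall
    obtain ⟨x, y, hxy⟩ := hS.exists_bracket_ne_zero
    exact hxy (h x y (hall x) (hall y))
  let f : C →ₗ[K] L := (S.bracket d).comp C.subtype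
  have hD := hS.finrank_le_finrank_ker_add_one f (fun x => hS.bracket_mem_center d x)
  obtain ⟨r, hr⟩ := hgen _ (hS.bracket_mem_center a d)
  have hr0 : r ≠ 0 := by
    rintro rfl
    exact hd (by simpa [C] using hr)
  -- Since `[a, d] ≠ 0`, `L = C + K d`. With `C` abelian, anything in `C` that commutes with `d` is
  -- therefore central.
  have hle : (LinearMap.ker f).map C.subtype ≤ S.center := by
    rintro _ ⟨x, hx, rfl⟩
    have hdx : S.bracket d x = 0 := hx
    rw [S.mem_center]
    intro y
    obtain ⟨s, hs⟩ := hgen _ (hS.bracket_mem_center a y)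
    have hy : S.bracket a (y - (s * r⁻¹) • d) = 0 := by
      rw [map_sub, map_smul, hr, hs, smul_smul, inv_mul_cancel_right₀ hr0, sub_self]
    have hxy := h x _ x.2 hy
    rw [map_sub, map_smul, hS.bracket_skew _ d, hdx, neg_zero, smul_zero, sub_zero] at hxy
    exact hxy
  -- Two kernels cost at most two dimensions, leaving at least `2m - 1 ≥ 3` inside a one-dimensional
  -- center.
  have h4 := Submodule.finrank_mono hle
  rw [hS.finrank_center, Submodule.finrank_map_subtype_eq] at h4
  omega

end IsSpecialHeisenberg

end Heisenberg

/-! ### The obstruction to 2-capability -/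

section Obstruction

variable {K : Type u} {L : Type v} {H : Type w} [Field K] [AddCommGroup L] [Module K L]
  [AddCommGroup H] [Module K H] {S : LieSuperalgebra K L} {T : LieSuperalgebra K H}

/-- A `2`-capable Lie superalgebra is the image of an even homomorphism with kernel the second
center. -/
theorem IsIsomorphic.exists_hom
    (h : S.IsIsomorphic (T.quotient (T.upperCentral 2) (T.upperCentral_isGradedIdeal 2))) :
    ∃ p : H →ₗ[K] L, (∀ x y, p (T.bracket x y) = S.bracket (p x) (p y)) ∧
      (∀ x, x ∈ T.upperCentral 2 ↔ p x = 0) ∧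
      (∀ i, ∀ x ∈ T.grade i, p x ∈ S.grade i) ∧
      ∀ i, ∀ y ∈ S.grade i, ∃ x ∈ T.grade i, p x = y := by
  obtain ⟨e, he, hb⟩ := h
  refine ⟨e.symm.toLinearMap.comp (T.upperCentral 2).mkQ, ?_, ?_, ?_, ?_⟩
  · intro x y
    apply e.injective
    rw [hb]
    simp only [LinearMap.comp_apply, LinearEquiv.coe_coe, LinearEquiv.apply_symm_apply]
    rfl
  · intro x
    simp
  · intro i x hx
    rw [he i]
    simp only [LinearMap.comp_apply, LinearEquiv.coe_coe, LinearEquiv.apply_symm_apply]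
    exact ⟨x, hx, rfl⟩
  · intro i y hy
    obtain ⟨x, hx, hxy⟩ := (he i y).1 hy
    exact ⟨x, hx, by simp [hxy]⟩

/-- If `[x, y]` lifts a nonzero multiple of `p z` and `[[x, y], h]` is central, then so is
`[z, h]`. -/
theorem bracket_mem_center_of_lift {p : H →ₗ[K] L}
    (hp : ∀ x, x ∈ T.upperCentral 2 ↔ p x = 0) {z g h : H} {c : K} (hc : c ≠ 0)
    (hg : p g = c • p z) (hgh : T.bracket g h ∈ T.center) : T.bracket z h ∈ T.center := by
  have h1 : g - c • z ∈ T.upperCentral 2 := by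
    rw [hp, map_sub, map_smul, hg, sub_self]
  have h2 : T.bracket (g - c • z) h ∈ T.center := h1 h
  rw [map_sub, map_smul, LinearMap.sub_apply, LinearMap.smul_apply] at h2
  have h3 := T.center.sub_mem hgh h2
  rw [sub_sub_cancel] at h3
  exact (T.center.smul_mem_iff hc).1 h3

/-- Jacobi expands `[h, [x, y]]` into brackets of `[h, x]` and `[h, y]`, which lie in the second
center, with `y` and `x`. -/
theorem bracket_mem_center_of_even {p : H →ₗ[K] L}
    (hb : ∀ x y, p (T.bracket x y) = S.bracket (p x) (p y))
    (hp : ∀ x, x ∈ T.upperCentral 2 ↔ p x = 0) {i : ZMod 2} {z h x y : H} {c : K} (hc : c ≠ 0)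
    (hh : h ∈ T.grade 0) (hx : x ∈ T.grade i) (hy : y ∈ T.grade i)
    (hhx : S.bracket (p h) (p x) = 0) (hhy : S.bracket (p h) (p y) = 0)
    (hxy : S.bracket (p x) (p y) = c • p z) : T.bracket z h ∈ T.center := by
  have hhx' : T.bracket h x ∈ T.upperCentral 2 := by rw [hp, hb, hhx]
  have hhy' : T.bracket h y ∈ T.upperCentral 2 := by rw [hp, hb, hhy]
  refine bracket_mem_center_of_lift hp hc ((hb x y).trans hxy) ?_
  refine T.bracket_mem_swap _ (T.bracket_mem i i x y hx hy) hh ?_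
  rw [T.jacobi 0 i h x y hh hx]
  refine T.center.add_mem (hhx' y) (T.center.smul_mem _ ?_)
  refine T.bracket_mem_swap _ hx (T.bracket_mem 0 i h y hh hy) (hhy' x)

/-- If `[p h, p h] ≠ 0`, then `[h, h]` replaces `z` and commutes with `h` by the cube axiom.
Otherwise `[h, h]` is in the second center, and `[h, k]` replaces `z` for a suitable odd `k`. -/
theorem bracket_mem_center_of_odd (hK : (2 : K) ≠ 0) {m n : ℕ} (hS : S.IsSpecialHeisenberg m n)
    {p : H →ₗ[K] L} (hb : ∀ x y, p (T.bracket x y) = S.bracket (p x) (p y))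
    (hp : ∀ x, x ∈ T.upperCentral 2 ↔ p x = 0)
    (hgr : ∀ i, ∀ x ∈ T.grade i, p x ∈ S.grade i)
    (hlift : ∀ i, ∀ y ∈ S.grade i, ∃ x ∈ T.grade i, p x = y) {z h : H}
    (hgen : ∀ w ∈ S.center, ∃ c : K, w = c • p z)
    (hz : z ∈ T.grade 0) (hh : h ∈ T.grade 1) : T.bracket z h ∈ T.center := by
  by_cases h0 : p h = 0
  · exact T.bracket_mem_swap _ hz hh ((hp h).2 h0 z)
  obtain ⟨b, hb1, hhb⟩ := hS.exists_odd_bracket_ne_zero (hgr 1 h hh) h0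
  obtain ⟨k, hk, rfl⟩ := hlift 1 b hb1
  obtain ⟨d, hd⟩ := hgen _ (hS.bracket_mem_center (p h) (p h))
  obtain ⟨c, hc⟩ := hgen _ (hS.bracket_mem_center (p h) (p k))
  by_cases hd0 : d = 0
  · have hc0 : c ≠ 0 := by
      rintro rfl
      exact hhb (by rw [hc, zero_smul])
    refine bracket_mem_center_of_lift hp hc0 ((hb h k).trans hc) ?_
    refine T.bracket_mem_swap _ (T.bracket_mem 1 1 h k hh hk) hh ?_
    have hhh : T.bracket h h ∈ T.upperCentral 2 := by rw [hp, hb, hd, hd0, zero_smul]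
    have hj := T.jacobi 1 1 h h k hh hh
    simp only [ZMod.val_one, mul_one, pow_one, neg_smul, one_smul] at hj
    -- Jacobi for the odd pair `h, h` reads `2[h, [h, k]] = [[h, h], k]`.
    rw [← T.center.smul_mem_iff hK, two_smul]
    nth_rewrite 1 [hj]
    rw [neg_add_cancel_right]
    exact hhh k
  · refine bracket_mem_center_of_lift hp hd0 ((hb h h).trans hd) ?_
    refine T.bracket_mem_swap _ (T.bracket_mem 1 1 h h hh hh) hh ?_
    rw [T.odd_cube h hh]
    exact T.center.zero_mem

theorem not_isIsomorphic_quotient (hK : (2 : K) ≠ 0) {m n : ℕ} (hS : S.IsSpecialHeisenberg m n)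
    (hmn : ¬(m = 1 ∧ n = 0)) :
    ¬S.IsIsomorphic (T.quotient (T.upperCentral 2) (T.upperCentral_isGradedIdeal 2)) := by
  intro hiso
  have := hS.finiteDimensional
  obtain ⟨p, hb, hp, hgr, hlift⟩ := hiso.exists_hom
  obtain ⟨z, hzc, hz0, hgen⟩ := hS.exists_center_generator
  obtain ⟨z, hz, rfl⟩ := hlift 0 z (hS.center_even hzc)
  have key : ∀ h ∈ T.grade 0, ∃ (i : ZMod 2) (x y : L), x ∈ S.grade i ∧ y ∈ S.grade i ∧
      S.bracket (p h) x = 0 ∧ S.bracket (p h) y = 0 ∧ S.bracket x y ≠ 0 := by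
    intro h hh
    rcases Nat.eq_zero_or_pos n with rfl | hn
    · have htop : ∀ x : L, x ∈ S.grade 0 := fun x => by
        rw [hS.grade_zero_eq_top]; exact Submodule.mem_top
      have hm : 2 ≤ m := by
        by_contra hm
        -- Here `L` would be one-dimensional, equal to its center, and so abelian.
        obtain rfl : m = 0 := by omega
        obtain ⟨a, b, hab⟩ := hS.exists_bracket_ne_zero
        have : S.center = ⊤ := Submodule.eq_top_of_finrank_eq (by
          rw [hS.finrank_center, hS.finrank_eq])
        have ha : a ∈ S.center := this ▸ Submodule.mem_top
        exact hab ((S.mem_center a).1 ha b)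
      obtain ⟨x, y, hx, hy, hxy⟩ := hS.exists_noncommuting_of_centralizer hm (p h)
      exact ⟨0, x, y, htop x, htop y, hx, hy, hxy⟩
    · have hne : S.grade 1 ≠ ⊥ := by
        intro h0
        have := hS.finrank_odd
        rw [h0, finrank_bot] at this
        omega
      obtain ⟨a, ha, ha0⟩ := Submodule.exists_mem_ne_zero_of_ne_bot hne
      obtain ⟨b, hb1, hab⟩ := hS.exists_odd_bracket_ne_zero ha ha0
      exact ⟨1, a, b, ha, hb1, hS.bracket_even_odd (hgr 0 h hh) ha,
        hS.bracket_even_odd (hgr 0 h hh) hb1, hab⟩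
  refine hz0 ((hp z).1 fun h => ?_)
  obtain ⟨h₀, hh₀, h₁, hh₁, rfl⟩ := T.exists_add h
  rw [map_add]
  refine Submodule.add_mem _ ?_
    (bracket_mem_center_of_odd hK hS hb hp hgr hlift hgen hz hh₁)
  obtain ⟨i, x, y, hx, hy, hhx, hhy, hxy⟩ := key h₀ hh₀
  obtain ⟨x, hx', rfl⟩ := hlift i x hx
  obtain ⟨y, hy', rfl⟩ := hlift i y hy
  obtain ⟨c, hc⟩ := hgen _ (hS.bracket_mem_center (p x) (p y))
  refine bracket_mem_center_of_even hb hp (c := c) ?_ hh₀ hx' hy' hhx hhy hc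
  rintro rfl
  exact hxy (by rw [hc, zero_smul])

end Obstruction

/-! ### The five-dimensional filiform algebra -/

section Filiform

variable (K : Type u) [Field K]

/-- The bracket `[e₀, e₁] = e₂`, `[e₀, e₂] = e₃`, `[e₀, e₃] = e₄` on `K⁵`. -/
def filiformBracket :
    (ULift.{w} (Fin 5) → K) →ₗ[K] (ULift.{w} (Fin 5) → K) →ₗ[K] (ULift.{w} (Fin 5) → K) :=
  LinearMap.mk₂ K
    (fun x y i => ![0, 0, x ⟨0⟩ * y ⟨1⟩ - x ⟨1⟩ * y ⟨0⟩, x ⟨0⟩ * y ⟨2⟩ - x ⟨2⟩ * y ⟨0⟩,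
      x ⟨0⟩ * y ⟨3⟩ - x ⟨3⟩ * y ⟨0⟩] i.down)
    (by intro x x' y; ext ⟨i⟩; fin_cases i <;> simp <;> ring)
    (by intro c x y; ext ⟨i⟩; fin_cases i <;> simp <;> ring)
    (by intro x y y'; ext ⟨i⟩; fin_cases i <;> simp <;> ring)
    (by intro c x y; ext ⟨i⟩; fin_cases i <;> simp <;> ring)

theorem filiformBracket_apply (x y : ULift.{w} (Fin 5) → K) (i : ULift.{w} (Fin 5)) :
    filiformBracket K x y i = ![0, 0, x ⟨0⟩ * y ⟨1⟩ - x ⟨1⟩ * y ⟨0⟩,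
      x ⟨0⟩ * y ⟨2⟩ - x ⟨2⟩ * y ⟨0⟩, x ⟨0⟩ * y ⟨3⟩ - x ⟨3⟩ * y ⟨0⟩] i.down :=
  rfl

theorem filiformBracket_skew (x y : ULift.{w} (Fin 5) → K) :
    filiformBracket K x y = -filiformBracket K y x := by
  ext ⟨i⟩
  fin_cases i <;> simp [filiformBracket_apply] <;> ring

theorem filiformBracket_jacobi (x y z : ULift.{w} (Fin 5) → K) :
    filiformBracket K x (filiformBracket K y z) =
      filiformBracket K (filiformBracket K x y) z +
        filiformBracket K y (filiformBracket K x z) := by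
  ext ⟨i⟩
  fin_cases i <;> simp [filiformBracket_apply] <;> ring

theorem zmod_two_eq_zero_or_one : ∀ i : ZMod 2, i = 0 ∨ i = 1 := by decide

/-- The five-dimensional filiform Lie algebra, as a purely even Lie superalgebra. -/
def filiform : LieSuperalgebra K (ULift.{w} (Fin 5) → K) where
  grade i := if i = 0 then ⊤ else ⊥
  isCompl := by simpa using isCompl_top_bot
  bracket := filiformBracket K
  bracket_mem := by
    intro i j x y hx hy
    rcases zmod_two_eq_zero_or_one i with rfl | rfl <;>
      rcases zmod_two_eq_zero_or_one j with rfl | rfl <;> simp_all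
  skew := by
    intro i j x y hx hy
    rcases zmod_two_eq_zero_or_one i with rfl | rfl <;>
      rcases zmod_two_eq_zero_or_one j with rfl | rfl <;> simp_all
    exact filiformBracket_skew K x y
  jacobi := by
    intro i j x y z hx hy
    rcases zmod_two_eq_zero_or_one i with rfl | rfl <;>
      rcases zmod_two_eq_zero_or_one j with rfl | rfl <;> simp_all
    exact filiformBracket_jacobi K x y z
  odd_cube := by
    intro x hx
    simp_all

theorem filiform_bracket : (filiform.{u, w} K).bracket = filiformBracket.{u, w} K := rfl

theorem mem_upperCentral_two_filiform (x : ULift.{w} (Fin 5) → K) :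
    x ∈ (filiform.{u, w} K).upperCentral 2 ↔ x ⟨0⟩ = 0 ∧ x ⟨1⟩ = 0 ∧ x ⟨2⟩ = 0 := by
  have h : x ∈ (filiform.{u, w} K).upperCentral 2 ↔
      ∀ y z, filiformBracket K (filiformBracket K x y) z = 0 :=
    forall_congr' fun y => (filiform.{u, w} K).mem_center _
  rw [h]
  constructor
  · intro hx
    -- It suffices to test two double brackets: `[[x, e₁], e₀] = -x₀ e₃` and `[[x, e₀], e₀] = x₁ e₃
    -- + x₂ e₄`.
    have key : ∀ y : ULift.{w} (Fin 5) → K, _ := fun y =>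
      hx y (Pi.single ⟨0⟩ 1)
    have h0 := congrFun (key (Pi.single ⟨1⟩ 1)) ⟨3⟩
    have h1 := congrFun (key (Pi.single ⟨0⟩ 1)) ⟨3⟩
    have h2 := congrFun (key (Pi.single ⟨0⟩ 1)) ⟨4⟩
    simp [filiformBracket_apply, ULift.ext_iff] at h0 h1 h2
    exact ⟨h0, h1, h2⟩
  · rintro ⟨h0, h1, h2⟩ y z
    ext ⟨i⟩
    fin_cases i <;> simp [filiformBracket_apply, h0, h1, h2]

end Filiform

/-! ### 2-capability of `H(1, 0)` -/

section Capable

variable {K : Type u} {L : Type v} [Field K] [AddCommGroup L] [Module K L]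
  {S : LieSuperalgebra K L}

/-- Any noncommuting `a, b` give a basis `a, b, [a, b]`, matching `e₀, e₁, e₂` modulo the second
center `⟨e₃, e₄⟩` of the filiform algebra. -/
theorem IsSpecialHeisenberg.isTwoCapable (hK : (2 : K) ≠ 0) (hS : S.IsSpecialHeisenberg 1 0) :
    IsTwoCapable.{u, v, w} S := by
  have := hS.finiteDimensional
  obtain ⟨a, b, hab⟩ := hS.exists_bracket_ne_zero
  have htop : ∀ x : L, x ∈ S.grade 0 := fun x => by
    rw [hS.grade_zero_eq_top]; exact Submodule.mem_top
  have haa := S.bracket_self_of_even hK (htop a)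
  have hbb := S.bracket_self_of_even hK (htop b)
  have hba := hS.bracket_skew b a
  have hz := (S.mem_center _).1 (hS.bracket_mem_center a b)
  have hz' : ∀ x, S.bracket x (S.bracket a b) = 0 := fun x => by
    rw [hS.bracket_skew, hz, neg_zero]
  have hli : LinearIndependent K ![a, b, S.bracket a b] := by
    rw [Fintype.linearIndependent_iff]
    intro g hg
    rw [Fin.sum_univ_three] at hg
    -- Bracketing the relation with `b`, then with `a`, isolates the first two coefficients as
    -- multiples of `[a, b]`.
    have h0 := congrArg (fun t => S.bracket t b) hg
    have h1 := congrArg (fun t => S.bracket a t) hg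
    simp [haa, hbb, hz, hz', hab] at h0 h1
    simp [h0, h1, hab] at hg
    intro i
    fin_cases i
    exacts [h0, h1, hg]
  let q : (ULift.{w} (Fin 5) → K) →ₗ[K] L :=
    (LinearMap.proj ⟨0⟩).smulRight a + (LinearMap.proj ⟨1⟩).smulRight b +
      (LinearMap.proj ⟨2⟩).smulRight (S.bracket a b)
  have hq : ∀ x, q x = x ⟨0⟩ • a + x ⟨1⟩ • b + x ⟨2⟩ • S.bracket a b := fun x => rfl
  have hqb : ∀ x y, q ((filiform K).bracket x y) = S.bracket (q x) (q y) := by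
    intro x y
    simp only [hq, map_add, map_smul, LinearMap.add_apply, LinearMap.smul_apply, haa, hbb, hba,
      hz, hz', filiform_bracket, filiformBracket_apply]
    simp
    module
  have hker : (filiform.{u, w} K).upperCentral 2 = LinearMap.ker q := by
    ext x
    rw [mem_upperCentral_two_filiform, LinearMap.mem_ker, hq]
    constructor
    · rintro ⟨h0, h1, h2⟩
      simp [h0, h1, h2]
    · intro h
      have h0 := congrArg (fun t => S.bracket t b) h
      have h1 := congrArg (fun t => S.bracket a t) h
      simp [haa, hbb, hz, hz', hab] at h0 h1
      simpa [h0, h1, hab] using h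
  have hsurj : Function.Surjective q := by
    intro y
    have hy : y ∈ Submodule.span K (Set.range ![a, b, S.bracket a b]) := by
      rw [hli.span_eq_top_of_card_eq_finrank (by rw [hS.finrank_eq]; simp)]
      exact Submodule.mem_top
    obtain ⟨c, hc⟩ := (Submodule.mem_span_range_iff_exists_fun K).1 hy
    refine ⟨fun i => ![c 0, c 1, c 2, 0, 0] i.down, ?_⟩
    rw [hq, ← hc, Fin.sum_univ_three]
    rfl
  let e := (Submodule.quotEquivOfEq _ _ hker).trans (q.quotKerEquivOfSurjective hsurj)
  have he : ∀ x, e (Submodule.Quotient.mk x) = q x := fun x => rfl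
  refine ⟨_, _, _, filiform.{u, w} K, e.symm, ?_, ?_⟩
  · intro i x
    rcases zmod_two_eq_zero_or_one i with rfl | rfl
    · refine iff_of_true (htop x) ?_
      obtain ⟨x, rfl⟩ := hsurj x
      rw [← he, LinearEquiv.symm_apply_apply]
      exact ⟨x, Submodule.mem_top, rfl⟩
    · have hbot : ((filiform.{u, w} K).quotient _
          ((filiform.{u, w} K).upperCentral_isGradedIdeal 2)).grade 1 = ⊥ :=
        Submodule.map_bot _
      rw [hbot, hS.grade_one_eq_bot]
      simp
  · intro x y
    obtain ⟨x, rfl⟩ := hsurj x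
    obtain ⟨y, rfl⟩ := hsurj y
    rw [← hqb, ← he, ← he, ← he]
    simp only [LinearEquiv.symm_apply_apply]
    rfl

end Capable

end LieSuperalgebra

theorem mainTheorem10 {K : Type u} [Field K] (hK : (2 : K) ≠ 0)
    {L : Type v} [AddCommGroup L] [Module K L] (S : LieSuperalgebra K L) (m n : ℕ)
    (hS : S.IsSpecialHeisenberg m n) :
    LieSuperalgebra.IsTwoCapable.{u, v, w} S ↔ m = 1 ∧ n = 0 := by
  constructor
  · rintro ⟨H, _, _, T, hT⟩
    by_contra hmn
    exact LieSuperalgebra.not_isIsomorphic_quotient hK hS hmn hT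
  · rintro ⟨rfl, rfl⟩
    exact hS.isTwoCapable hK
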